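/- Let $W=\{W(t),t\ge 0\}$ be a standard Brownian motion and put $\Psi(x)=\mathbf P\{W(1)>x\}=\int_x^\infty e^{-u^2/2}\,\frac{du}{\sqrt{2\pi}}$ for $x\in\mathbb R$. There exists an absolute constant $C$ such that, for every real $M$ and all $0<a<b<\infty$, $$\mathbf P\Big\{\inf_{a\le t\le b}|W(t)-M|=0\Big\}=2\int_{\mathbb R}\Psi\Big(\frac{|v|}{\sqrt{b-a}}\Big)\frac{e^{-(M+v)^2/(2a)}}{\sqrt{2\pi a}}\,dv\le C\min\Big(1,\ \sqrt{\frac{b-a}{a}}\;e^{-M^2/(8\max(a,\,b-a))}\Big).$$ In particular, $$\mathbf P\Big\{\inf_{a\le t\le b}|W(t)-M|=0\Big\}\le C\min\Big(1,\sqrt{\frac{b-a}{a}}\Big).$$ -/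

import Mathlib

open MeasureTheory ProbabilityTheory
open scoped NNReal

/-- The tail of the standard normal law, `Ψ(x) = ∫_x^∞ e^{-u²/2} du / √(2π)`. -/
noncomputable def Psi (x : ℝ) : ℝ :=
  ∫ u in Set.Ioi x, Real.exp (-u ^ 2 / 2) / Real.sqrt (2 * Real.pi)

/-- The event `{inf_{a ≤ t ≤ b} |W(t) - M| = 0}`. For `a ≤ b` the infimum is over a nonempty set
of nonnegative reals, so it is the usual one. -/
def infZeroEvent {Ω : Type*} (W : ℝ≥0 → Ω → ℝ) (a b : ℝ≥0) (M : ℝ) : Set Ω :=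
  {ω | ⨅ t : Set.Icc a b, |W t ω - M| = 0}

/-- The integrand `v ↦ Ψ(|v| / √(b - a)) e^{-(M + v)² / (2a)} / √(2πa)`. -/
noncomputable def hitIntegrand (a b M v : ℝ) : ℝ :=
  Psi (|v| / Real.sqrt (b - a)) *
    (Real.exp (-(M + v) ^ 2 / (2 * a)) / Real.sqrt (2 * Real.pi * a))

/-! ### Reflection for sequences with symmetric increments independent of the past. -/

section FirstPassage

variable {Ω : Type*} {mΩ : MeasurableSpace Ω} {P : Measure Ω}

/-! For continuous paths the infimum vanishes exactly when the path visits `M` during `[a, b]`.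
Given `W a = y`, the process restarted at time `a` is a fresh Brownian motion that must visit `M -
y` before time `b - a`; by the reflection principle this has probability `2 Psi (|M - y| / √(b -
a))`. Averaging over the Gaussian `y = M + v` gives the formula (`measure_infZeroEvent`).

The reflection principle (`measureReal_exists_le_brownian`) is obtained on finite grids, without the
strong Markov property: Lévy's maximal inequality bounds the probability above, and a converse with
overshoot `ε` bounds it below; then the mesh and `ε` tend to zero.

For the estimate, `Psi x ≤ exp (-x² / 2) / 2` makes the integrand at most a product of two Gaussian
kernels. Completing the square gives the bound `√((b - a) / b) exp (-M² / (2b))`, and `a ≤ b ≤ 2 max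
a (b - a)` turns it into the stated one, with `C = 1`. -/

lemma measureReal_inter_lt_neg_eq_inter_lt {α : Type*} {mα : MeasurableSpace α}
    {Y : Ω → α} {Z : Ω → ℝ} (hZ : Measurable Z)
    (hind : IndepFun Z Y P) (hsymm : P.map (fun ω ↦ -Z ω) = P.map Z)
    {A : Set α} (hA : MeasurableSet A) (c : ℝ) :
    P.real (Y ⁻¹' A ∩ {ω | Z ω < -c}) = P.real (Y ⁻¹' A ∩ {ω | c < Z ω}) := by
  have h1 := hind.measure_inter_preimage_eq_mul _ _ (measurableSet_Iio (a := -c)) hA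
  have h2 := hind.measure_inter_preimage_eq_mul _ _ (measurableSet_Ioi (a := c)) hA
  have h3 : P (Z ⁻¹' Set.Iio (-c)) = P (Z ⁻¹' Set.Ioi c) := by
    rw [← Measure.map_apply hZ measurableSet_Ioi, ← hsymm,
      Measure.map_apply (f := fun ω ↦ -Z ω) hZ.neg measurableSet_Ioi]
    congr 1
    ext ω
    simp only [Set.mem_preimage, Set.mem_Iio, Set.mem_Ioi]
    exact lt_neg
  rw [h3, ← h2] at h1
  rw [measureReal_def, measureReal_def, Set.inter_comm, Set.inter_comm (Y ⁻¹' A)]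
  exact congrArg ENNReal.toReal h1

/-- The event that `k` is the first index at which `S` reaches level `x`. -/
def firstPassage (S : ℕ → Ω → ℝ) (x : ℝ) (k : ℕ) : Set Ω :=
  {ω | x ≤ S k ω ∧ ∀ j < k, S j ω < x}

/-- The event that `S` reaches level `x` at some index `k ≤ n`. -/
def passageBy (S : ℕ → Ω → ℝ) (x : ℝ) (n : ℕ) : Set Ω :=
  {ω | ∃ k ≤ n, x ≤ S k ω}

variable {S : ℕ → Ω → ℝ} {x : ℝ} {n : ℕ}

lemma measurableSet_firstPassage (hS : ∀ k, Measurable (S k)) (k : ℕ) :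
    MeasurableSet (firstPassage S x k) := by
  refine (measurableSet_le measurable_const (hS k)).inter ?_
  have : {ω | ∀ j < k, S j ω < x} = ⋂ j, ⋂ (_ : j < k), {ω | S j ω < x} := by ext; simp
  change MeasurableSet {ω | ∀ j < k, S j ω < x}
  rw [this]
  exact .iInter fun j ↦ .iInter fun _ ↦ measurableSet_lt (hS j) measurable_const

lemma measureReal_passageBy_inter [IsFiniteMeasure P] (hS : ∀ k, Measurable (S k))
    {F : Set Ω} (hF : MeasurableSet F) :
    P.real (passageBy S x n ∩ F) =
      ∑ k ∈ Finset.range (n + 1), P.real (firstPassage S x k ∩ F) := by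
  rw [← measureReal_biUnion_finset]
  · congr 1
    ext ω
    simp only [passageBy, firstPassage, Set.mem_inter_iff, Set.mem_ofPred_eq, Set.mem_iUnion,
      Finset.mem_range, Nat.lt_succ_iff, exists_prop]
    classical
    constructor
    · rintro ⟨h, hω⟩
      have h' : ∃ k, x ≤ S k ω := h.imp fun k hk ↦ hk.2
      obtain ⟨k, hk, hkx⟩ := h
      exact ⟨Nat.find h', (Nat.find_min' h' hkx).trans hk,
        ⟨Nat.find_spec h', fun j hj ↦ not_le.1 (Nat.find_min h' hj)⟩, hω⟩
    · rintro ⟨k, hk, ⟨hkx, -⟩, hω⟩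
      exact ⟨⟨k, hk, hkx⟩, hω⟩
  · intro i _ j _ hij
    refine Set.disjoint_left.2 ?_
    rintro ω ⟨⟨hi, hi'⟩, -⟩ ⟨⟨hj, hj'⟩, -⟩
    rcases lt_or_gt_of_ne hij with h | h
    · exact (hj' i h).not_ge hi
    · exact (hi' j h).not_ge hj
  · exact fun k _ ↦ (measurableSet_firstPassage hS k).inter hF

/-- First passage at `k` depends only on the path up to `k`, so the later increment may change sign.
The set `U` allows the overshoot at passage to be controlled. -/
lemma measureReal_firstPassage_reflect [IsFiniteMeasure P] (hS : ∀ k, Measurable (S k)) {k : ℕ}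
    (hind : IndepFun (fun ω ↦ S n ω - S k ω) (fun ω (j : Set.Iic k) ↦ S j ω) P)
    (hsymm : P.map (fun ω ↦ -(S n ω - S k ω)) = P.map (fun ω ↦ S n ω - S k ω))
    {U : Set ℝ} (hU : MeasurableSet U) (c : ℝ) :
    P.real ((firstPassage S x k ∩ S k ⁻¹' U) ∩ {ω | S n ω - S k ω < -c}) =
      P.real ((firstPassage S x k ∩ S k ⁻¹' U) ∩ {ω | c < S n ω - S k ω}) := by
  have hA : MeasurableSet {p : Set.Iic k → ℝ | (x ≤ p ⟨k, Set.self_mem_Iic⟩ ∧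
      ∀ j : Set.Iic k, j.1 < k → p j < x) ∧ p ⟨k, Set.self_mem_Iic⟩ ∈ U} := by
    refine MeasurableSet.inter (MeasurableSet.inter ?_ ?_) ?_
    · exact measurableSet_le measurable_const (measurable_pi_apply _)
    · have : {p : Set.Iic k → ℝ | ∀ j : Set.Iic k, j.1 < k → p j < x} =
          ⋂ j : Set.Iic k, ⋂ (_ : j.1 < k), {p | p j < x} := by ext; simp
      change MeasurableSet {p : Set.Iic k → ℝ | ∀ j : Set.Iic k, j.1 < k → p j < x}
      rw [this]
      exact .iInter fun j ↦ .iInter fun _ ↦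
        measurableSet_lt (measurable_pi_apply _) measurable_const
    · exact measurable_pi_apply _ hU
  have := measureReal_inter_lt_neg_eq_inter_lt (P := P)
    (Y := fun ω (j : Set.Iic k) ↦ S j ω) (Z := fun ω ↦ S n ω - S k ω)
    ((hS n).sub (hS k)) hind hsymm hA c
  convert this using 3 <;>
  · ext ω
    simp only [firstPassage, Set.mem_inter_iff, Set.mem_ofPred_eq, Set.mem_preimage,
      Subtype.forall, Set.mem_Iic]
    exact and_congr_left fun _ ↦ and_congr_right fun _ ↦
      ⟨fun h j _ hj ↦ h j hj, fun h j hj ↦ h j hj.le hj⟩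

lemma measureReal_passageBy_eq_add [IsFiniteMeasure P] (hS : ∀ k, Measurable (S k)) :
    P.real (passageBy S x n) =
      P.real {ω | x ≤ S n ω} + P.real (passageBy S x n ∩ {ω | S n ω < x}) := by
  have hm : MeasurableSet {ω | x ≤ S n ω} := measurableSet_le measurable_const (hS n)
  rw [← measureReal_inter_add_sdiff (s := passageBy S x n) hm]
  congr 2
  · exact Set.inter_eq_right.2 fun ω hω ↦ ⟨n, le_rfl, hω⟩
  · ext ω
    simp

/-- **Lévy's maximal inequality** for sums of independent symmetric increments. -/
lemma measureReal_passageBy_le [IsFiniteMeasure P] (hS : ∀ k, Measurable (S k))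
    (hind : ∀ k ≤ n, IndepFun (fun ω ↦ S n ω - S k ω) (fun ω (j : Set.Iic k) ↦ S j ω) P)
    (hsymm : ∀ k ≤ n, P.map (fun ω ↦ -(S n ω - S k ω)) = P.map (fun ω ↦ S n ω - S k ω)) :
    P.real (passageBy S x n) ≤ 2 * P.real {ω | x ≤ S n ω} := by
  have hlt : MeasurableSet {ω | S n ω < x} := measurableSet_lt (hS n) measurable_const
  have hle : MeasurableSet {ω | x ≤ S n ω} := measurableSet_le measurable_const (hS n)
  -- If the walk passes `x` at `k` but ends below it, the later increment is negative; flipping its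
  -- sign makes the walk end above `x`.
  have key : P.real (passageBy S x n ∩ {ω | S n ω < x}) ≤ P.real {ω | x ≤ S n ω} := calc
    _ = ∑ k ∈ Finset.range (n + 1), P.real (firstPassage S x k ∩ {ω | S n ω < x}) :=
      measureReal_passageBy_inter hS hlt
    _ ≤ ∑ k ∈ Finset.range (n + 1), P.real (firstPassage S x k ∩ {ω | x ≤ S n ω}) := by
      refine Finset.sum_le_sum fun k hk ↦ ?_
      have hk' : k ≤ n := Nat.lt_succ_iff.1 (Finset.mem_range.1 hk)
      have := measureReal_firstPassage_reflect (x := x) hS (hind k hk') (hsymm k hk')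
        MeasurableSet.univ 0
      simp only [Set.preimage_univ, Set.inter_univ, neg_zero] at this
      calc
        _ ≤ P.real (firstPassage S x k ∩ {ω | S n ω - S k ω < 0}) := by
          refine measureReal_mono ?_
          rintro ω ⟨h1, h2⟩
          exact ⟨h1, sub_neg.2 (lt_of_lt_of_le h2 h1.1)⟩
        _ ≤ _ := by
          rw [this]
          refine measureReal_mono ?_
          rintro ω ⟨h1, h2⟩
          exact ⟨h1, h1.1.trans (sub_pos.1 h2).le⟩
    _ = P.real (passageBy S x n ∩ {ω | x ≤ S n ω}) := (measureReal_passageBy_inter hS hle).symm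
    _ ≤ _ := measureReal_mono Set.inter_subset_right
  rw [measureReal_passageBy_eq_add hS]
  linarith

/-- The converse of Lévy's maximal inequality, up to an overshoot `ε`. -/
lemma le_measureReal_passageBy [IsFiniteMeasure P] (hS : ∀ k, Measurable (S k))
    (hind : ∀ k ≤ n, IndepFun (fun ω ↦ S n ω - S k ω) (fun ω (j : Set.Iic k) ↦ S j ω) P)
    (hsymm : ∀ k ≤ n, P.map (fun ω ↦ -(S n ω - S k ω)) = P.map (fun ω ↦ S n ω - S k ω))
    (h0 : ∀ ω, S 0 ω < x) {ε : ℝ} (hε : 0 ≤ ε) :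
    P.real {ω | x ≤ S n ω} + P.real {ω | x + 2 * ε ≤ S n ω} ≤
      P.real (passageBy S x n) + P.real {ω | ∃ k < n, ε ≤ S (k + 1) ω - S k ω} := by
  set G := {ω | ∃ k < n, ε ≤ S (k + 1) ω - S k ω} with hG
  have hGm : MeasurableSet G := by
    have : G = ⋃ k, ⋃ (_ : k < n), {ω | ε ≤ S (k + 1) ω - S k ω} := by ext; simp [hG]
    rw [this]
    exact .iUnion fun k ↦ .iUnion fun _ ↦
      measurableSet_le measurable_const ((hS (k + 1)).sub (hS k))
  have hlt : MeasurableSet {ω | S n ω < x} := measurableSet_lt (hS n) measurable_const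
  have hle : MeasurableSet {ω | x + 2 * ε ≤ S n ω} := measurableSet_le measurable_const (hS n)
  -- Off `G` every step is below `ε`, so the first passage lands below `x + ε`. Ending above `x + 2
  -- * ε` then needs an increment above `ε`, and its reflection ends below `x`.
  have key : P.real (passageBy S x n ∩ ({ω | x + 2 * ε ≤ S n ω} \ G)) ≤
      P.real (passageBy S x n ∩ {ω | S n ω < x}) := by
    rw [measureReal_passageBy_inter hS (hle.diff hGm), measureReal_passageBy_inter hS hlt]
    refine Finset.sum_le_sum fun k hk ↦ ?_
    have hk' : k ≤ n := Nat.lt_succ_iff.1 (Finset.mem_range.1 hk)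
    have := measureReal_firstPassage_reflect (x := x) hS (hind k hk') (hsymm k hk')
      (measurableSet_Iio (a := x + ε)) ε
    calc
      _ ≤ P.real ((firstPassage S x k ∩ S k ⁻¹' Set.Iio (x + ε)) ∩ {ω | ε < S n ω - S k ω}) := by
        refine measureReal_mono ?_
        rintro ω ⟨h1, h2, h3⟩
        have h4 : S k ω < x + ε := by
          rcases k with _ | j
          -- Index `0` has no preceding step to bound the overshoot, hence the need to start below
          -- `x`.
          · exact absurd h1.1 (h0 ω).not_ge
          · have h5 := h1.2 j j.lt_succ_self
            have h6 : S (j + 1) ω - S j ω < ε := by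
              by_contra! h
              exact h3 ⟨j, hk', h⟩
            linarith
        refine ⟨⟨h1, h4⟩, ?_⟩
        simp only [Set.mem_ofPred_eq] at h2 ⊢
        linarith
      _ ≤ _ := by
        rw [← this]
        refine measureReal_mono ?_
        rintro ω ⟨⟨h1, h2⟩, h3⟩
        refine ⟨h1, ?_⟩
        simp only [Set.mem_ofPred_eq, Set.mem_preimage, Set.mem_Iio] at h2 h3 ⊢
        linarith
  have hcover : P.real {ω | x + 2 * ε ≤ S n ω} ≤
      P.real (passageBy S x n ∩ ({ω | x + 2 * ε ≤ S n ω} \ G)) + P.real G := by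
    refine (measureReal_mono ?_).trans (measureReal_union_le _ _)
    intro ω hω
    by_cases h : ω ∈ G
    · exact Or.inr h
    · refine Or.inl ⟨⟨n, le_rfl, ?_⟩, hω, h⟩
      simp only [Set.mem_ofPred_eq] at hω
      linarith
  rw [measureReal_passageBy_eq_add hS]
  linarith

end FirstPassage

/-! ### The Gaussian tail. -/

section Psi

lemma Psi_eq_measureReal (x : ℝ) : Psi x = (gaussianReal 0 1).real (Set.Ioi x) := by
  rw [measureReal_def, gaussianReal_apply_eq_integral 0 one_ne_zero,
    ENNReal.toReal_ofReal (integral_nonneg fun _ ↦ gaussianPDFReal_nonneg _ _ _), Psi]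
  congr 1
  ext u
  simp [gaussianPDFReal]
  ring

lemma Psi_nonneg (x : ℝ) : 0 ≤ Psi x := by
  rw [Psi_eq_measureReal]
  exact measureReal_nonneg

lemma Psi_antitone : Antitone Psi := fun x y h ↦ by
  rw [Psi_eq_measureReal, Psi_eq_measureReal]
  exact measureReal_mono (Set.Ioi_subset_Ioi h)

lemma measurable_Psi : Measurable Psi := Psi_antitone.measurable

lemma Psi_eq_measureReal_Ici (x : ℝ) : Psi x = (gaussianReal 0 1).real (Set.Ici x) := by
  have := nullSingletonClass_gaussianReal (μ := 0) (v := 1) one_ne_zero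
  rw [Psi_eq_measureReal]
  exact measureReal_congr Ioi_ae_eq_Ici

lemma Psi_neg (x : ℝ) : Psi (-x) = 1 - Psi x := by
  have h1 : Psi (-x) = (gaussianReal 0 1).real (Set.Iic x) := by
    rw [Psi_eq_measureReal_Ici, measureReal_def, measureReal_def]
    conv_rhs => rw [← neg_zero, ← gaussianReal_map_neg,
      Measure.map_apply measurable_neg measurableSet_Iic]
    congr 2
    ext y
    simp
  rw [h1, Psi_eq_measureReal, ← Set.compl_Iic, probReal_compl_eq_one_sub measurableSet_Iic]
  ring

lemma Psi_zero : Psi 0 = 1 / 2 := by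
  have := Psi_neg 0
  rw [neg_zero] at this
  linarith

lemma integrable_exp_neg_sq_div_sqrt :
    Integrable fun u : ℝ ↦ Real.exp (-u ^ 2 / 2) / Real.sqrt (2 * Real.pi) := by
  have := integrable_exp_neg_mul_sq (b := 1 / 2) (by norm_num)
  refine (this.div_const (Real.sqrt (2 * Real.pi))).congr (.of_forall fun u ↦ ?_)
  simp only
  congr 2
  ring

lemma continuous_Psi : Continuous Psi := by
  have h (x : ℝ) : Psi x = Psi 0 -
      ∫ u in (0 : ℝ)..x, Real.exp (-u ^ 2 / 2) / Real.sqrt (2 * Real.pi) := by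
    rw [Psi, Psi, ← intervalIntegral.integral_Ioi_sub_Ioi'
      integrable_exp_neg_sq_div_sqrt.integrableOn integrable_exp_neg_sq_div_sqrt.integrableOn]
    ring
  rw [funext h]
  exact continuous_const.sub (intervalIntegral.continuous_primitive
    (fun _ _ ↦ integrable_exp_neg_sq_div_sqrt.intervalIntegrable) 0)

/-- After the shift `u = w + x`, the cross term `w * x` is nonnegative and can be dropped. The
factor `1 / 2` is `Psi 0`. -/
lemma Psi_le_exp {x : ℝ} (hx : 0 ≤ x) : Psi x ≤ Real.exp (-x ^ 2 / 2) / 2 := by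
  have h1 : Psi x =
      ∫ w in Set.Ioi (0 : ℝ), Real.exp (-(w + x) ^ 2 / 2) / Real.sqrt (2 * Real.pi) := by
    rw [Psi, ← (measurePreserving_add_right volume x).setIntegral_preimage_emb
      (measurableEmbedding_addRight x), Set.preimage_add_const_Ioi, sub_self]
  have h2 : Real.exp (-x ^ 2 / 2) / 2 = ∫ w in Set.Ioi (0 : ℝ),
      Real.exp (-x ^ 2 / 2) * (Real.exp (-w ^ 2 / 2) / Real.sqrt (2 * Real.pi)) := by
    rw [integral_const_mul, ← Psi, Psi_zero]
    ring
  rw [h1, h2]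
  refine setIntegral_mono_on ?_ ?_ measurableSet_Ioi fun w hw ↦ ?_
  · exact (integrable_exp_neg_sq_div_sqrt.comp_add_right x).integrableOn
  · exact (integrable_exp_neg_sq_div_sqrt.const_mul _).integrableOn
  · rw [← mul_div_assoc, ← Real.exp_add]
    gcongr
    have : 0 ≤ w * x := mul_nonneg (le_of_lt hw) hx
    nlinarith

lemma gaussianReal_real_Ici {v : ℝ≥0} (hv : v ≠ 0) (x : ℝ) :
    (gaussianReal 0 v).real (Set.Ici x) = Psi (x / Real.sqrt v) := by
  have hs : 0 < Real.sqrt v := Real.sqrt_pos.2 (by positivity)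
  have h := gaussianReal_map_const_mul (μ := 0) (v := 1) (Real.sqrt v)
  have h' : gaussianReal 0 v = (gaussianReal 0 1).map (Real.sqrt v * ·) := by
    rw [h]
    congr 1
    · simp
    · ext
      simp
  rw [h', Psi_eq_measureReal_Ici, measureReal_def, measureReal_def,
    Measure.map_apply (measurable_const_mul _) measurableSet_Ici]
  congr 2
  ext y
  simp only [Set.mem_preimage, Set.mem_Ici]
  rw [div_le_iff₀ hs, mul_comm]

end Psi

/-! ### Gaussian bounds for the integral. -/

section HitIntegrand

variable {a b : ℝ}

lemma hitIntegrand_nonneg (a b M v : ℝ) : 0 ≤ hitIntegrand a b M v :=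
  mul_nonneg (Psi_nonneg _) (by positivity)

lemma measurable_hitIntegrand (a b M : ℝ) : Measurable (hitIntegrand a b M) := by
  unfold hitIntegrand
  exact (measurable_Psi.comp (by fun_prop)).mul (by fun_prop)

lemma sqrt_gaussian_ratio (ha : 0 < a) (hab : a < b) :
    Real.sqrt (Real.pi / (b / (2 * a * (b - a)))) / (2 * Real.sqrt (2 * Real.pi * a)) =
      Real.sqrt ((b - a) / b) / 2 := by
  have hb : 0 < b := ha.trans hab
  have hs : 0 < b - a := sub_pos.2 hab
  have h : Real.pi / (b / (2 * a * (b - a))) = ((b - a) / b) * (2 * Real.pi * a) := by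
    field_simp
  rw [h, Real.sqrt_mul (by positivity)]
  have : 0 < Real.sqrt (2 * Real.pi * a) := Real.sqrt_pos.2 (by positivity)
  field_simp

/-- Completing the square in the product of two Gaussian kernels. -/
lemma hitIntegrand_le (ha : 0 < a) (hab : a < b) (M v : ℝ) :
    hitIntegrand a b M v ≤ Real.exp (-M ^ 2 / (2 * b)) / (2 * Real.sqrt (2 * Real.pi * a)) *
      Real.exp (-(b / (2 * a * (b - a))) * (v + (b - a) / b * M) ^ 2) := by
  have hs : 0 < b - a := sub_pos.2 hab
  have hb : 0 < b := ha.trans hab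
  have h1 := Psi_le_exp (x := |v| / Real.sqrt (b - a)) (by positivity)
  have h2 : -(|v| / Real.sqrt (b - a)) ^ 2 / 2 = -v ^ 2 / (2 * (b - a)) := by
    rw [div_pow, Real.sq_sqrt hs.le, sq_abs]
    field_simp
  rw [h2] at h1
  calc hitIntegrand a b M v ≤ Real.exp (-v ^ 2 / (2 * (b - a))) / 2 *
        (Real.exp (-(M + v) ^ 2 / (2 * a)) / Real.sqrt (2 * Real.pi * a)) :=
      mul_le_mul_of_nonneg_right h1 (by positivity)
    _ = Real.exp (-v ^ 2 / (2 * (b - a)) + -(M + v) ^ 2 / (2 * a)) /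
        (2 * Real.sqrt (2 * Real.pi * a)) := by
      rw [Real.exp_add]
      field_simp
    _ = Real.exp (-M ^ 2 / (2 * b) + -(b / (2 * a * (b - a))) * (v + (b - a) / b * M) ^ 2) /
        (2 * Real.sqrt (2 * Real.pi * a)) := by
      congr 2
      field_simp
      ring
    _ = _ := by
      rw [Real.exp_add]
      ring

lemma integrable_hitIntegrand (ha : 0 < a) (hab : a < b) (M : ℝ) :
    Integrable (hitIntegrand a b M) := by
  have hc : 0 < b / (2 * a * (b - a)) :=
    div_pos (ha.trans hab) (mul_pos (by positivity) (sub_pos.2 hab))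
  refine (((integrable_exp_neg_mul_sq hc).comp_add_right ((b - a) / b * M)).const_mul
    (Real.exp (-M ^ 2 / (2 * b)) / (2 * Real.sqrt (2 * Real.pi * a)))).mono'
    (measurable_hitIntegrand a b M).aestronglyMeasurable (.of_forall fun v ↦ ?_)
  rw [Real.norm_of_nonneg (hitIntegrand_nonneg _ _ _ _)]
  exact hitIntegrand_le ha hab M v

lemma two_mul_integral_hitIntegrand_le (ha : 0 < a) (hab : a < b) (M : ℝ) :
    2 * ∫ v, hitIntegrand a b M v ≤ Real.sqrt ((b - a) / b) * Real.exp (-M ^ 2 / (2 * b)) := by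
  have hc : 0 < b / (2 * a * (b - a)) :=
    div_pos (ha.trans hab) (mul_pos (by positivity) (sub_pos.2 hab))
  have h := integral_mono (integrable_hitIntegrand ha hab M)
    (((integrable_exp_neg_mul_sq hc).comp_add_right ((b - a) / b * M)).const_mul
    (Real.exp (-M ^ 2 / (2 * b)) / (2 * Real.sqrt (2 * Real.pi * a)))) (hitIntegrand_le ha hab M)
  rw [integral_const_mul, integral_add_right_eq_self
    (fun v ↦ Real.exp (-(b / (2 * a * (b - a))) * v ^ 2)), integral_gaussian] at h
  calc
    _ ≤ 2 * (Real.exp (-M ^ 2 / (2 * b)) * (Real.sqrt (Real.pi / (b / (2 * a * (b - a)))) /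
        (2 * Real.sqrt (2 * Real.pi * a)))) := by
      refine mul_le_mul_of_nonneg_left (h.trans_eq ?_) zero_le_two
      ring
    _ = _ := by
      rw [sqrt_gaussian_ratio ha hab]
      ring

lemma two_mul_integral_hitIntegrand_le_sqrt_mul_exp (ha : 0 < a) (hab : a < b) (M : ℝ) :
    2 * ∫ v, hitIntegrand a b M v ≤
      Real.sqrt ((b - a) / a) * Real.exp (-M ^ 2 / (8 * max a (b - a))) := by
  have hb : 0 < b := ha.trans hab
  have hs : 0 < b - a := sub_pos.2 hab
  have hmax : 0 < max a (b - a) := lt_max_of_lt_left ha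
  refine (two_mul_integral_hitIntegrand_le ha hab M).trans ?_
  have h1 := le_max_left a (b - a)
  have h2 := le_max_right a (b - a)
  gcongr ?_ * Real.exp ?_
  · gcongr
  · rw [neg_div, neg_div, neg_le_neg_iff]
    -- Here `b = a + (b - a) ≤ 2 * max a (b - a)`, so `8` leaves room to spare.
    exact div_le_div_of_nonneg_left (sq_nonneg M) (by positivity) (by linarith)

end HitIntegrand

/-! ### The reflection principle for Brownian motion. -/

section Reflection

open Filter Topology

variable {Ω : Type*} {mΩ : MeasurableSpace Ω} {P : Measure Ω} {B : ℝ≥0 → Ω → ℝ}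

lemma ProbabilityTheory.IsPreBrownianReal.map_neg_sub (hB : IsPreBrownianReal B P) (s t : ℝ≥0) :
    P.map (fun ω ↦ -(B s ω - B t ω)) = P.map (fun ω ↦ B s ω - B t ω) := by
  have h : HasLaw (fun ω ↦ B s ω - B t ω) _ P := hB.hasLaw_sub s t
  rw [h.map_eq]
  exact (gaussianReal_neg h).map_eq.trans (by rw [neg_zero])

lemma ProbabilityTheory.IsPreBrownianReal.indepFun_sub_comp (hB : IsPreBrownianReal B P)
    {τ : ℕ → ℝ≥0} (hτ : Monotone τ) {k n : ℕ} (hkn : k ≤ n) :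
    IndepFun (fun ω ↦ B (τ n) ω - B (τ k) ω) (fun ω (j : Set.Iic k) ↦ B (τ j) ω) P := by
  have hφ : Measurable fun p : ℝ≥0 → ℝ ↦ p (τ n - τ k) := measurable_pi_apply _
  have hψ : Measurable fun (p : Set.Iic (τ k) → ℝ) (j : Set.Iic k) ↦ p ⟨τ j, hτ j.2⟩ :=
    measurable_pi_lambda _ fun j ↦ measurable_pi_apply _
  have h := (hB.indepFun_shift (τ k)).comp hφ hψ
  simpa only [Function.comp_def, add_tsub_cancel_of_le (hτ hkn)] using h

lemma ProbabilityTheory.IsPreBrownianReal.measureReal_le_eval (hB : IsPreBrownianReal B P)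
    {s : ℝ≥0} (hs : s ≠ 0) (x : ℝ) :
    P.real {ω | x ≤ B s ω} = Psi (x / Real.sqrt s) := by
  have h := hB.hasLaw_eval s
  rw [← gaussianReal_real_Ici hs, ← h.map_eq, measureReal_def, measureReal_def,
    Measure.map_apply_of_aemeasurable h.aemeasurable measurableSet_Ici]
  rfl

lemma ProbabilityTheory.IsPreBrownianReal.measureReal_le_sub (hB : IsPreBrownianReal B P)
    (t : ℝ≥0) {u : ℝ≥0} (hu : u ≠ 0) (x : ℝ) :
    P.real {ω | x ≤ B (t + u) ω - B t ω} = Psi (x / Real.sqrt u) :=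
  (hB.shift t).measureReal_le_eval hu x

/-- The `k`-th point of the grid dividing `[0, s]` into `n + 1` equal steps. -/
noncomputable def gridPoint (s : ℝ≥0) (n k : ℕ) : ℝ≥0 := k * (s / (n + 1))

lemma gridPoint_mono (s : ℝ≥0) (n : ℕ) : Monotone (gridPoint s n) := fun i j h ↦ by
  unfold gridPoint
  gcongr

lemma gridPoint_last (s : ℝ≥0) (n : ℕ) : gridPoint s n (n + 1) = s := by
  unfold gridPoint
  push_cast
  field_simp

lemma gridPoint_succ (s : ℝ≥0) (n k : ℕ) :
    gridPoint s n (k + 1) = gridPoint s n k + s / (n + 1) := by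
  unfold gridPoint
  push_cast
  ring

lemma gridPoint_le {s : ℝ≥0} {n k : ℕ} (hk : k ≤ n + 1) : gridPoint s n k ≤ s :=
  (gridPoint_mono s n hk).trans_eq (gridPoint_last s n)

lemma exists_tendsto_gridPoint {s t : ℝ≥0} (hs : s ≠ 0) (ht : t ≤ s) :
    ∃ k : ℕ → ℕ, (∀ n, k n ≤ n + 1) ∧ Tendsto (fun n ↦ gridPoint s n (k n)) atTop (𝓝 t) := by
  have hs' : (0 : ℝ) < s := by positivity
  refine ⟨fun n ↦ ⌊(t / s : ℝ) * ((n + 1 : ℕ) : ℝ)⌋₊, fun n ↦ ?_, ?_⟩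
  · exact Nat.floor_le_of_le (mul_le_of_le_one_left (Nat.cast_nonneg _)
      ((div_le_one hs').2 (by exact_mod_cast ht)))
  · have h := (tendsto_nat_floor_mul_div_atTop (R := ℝ) (a := (t / s : ℝ)) (by positivity)).comp
      ((tendsto_natCast_atTop_atTop (R := ℝ)).comp (tendsto_add_atTop_nat 1))
    have h2 := h.mul_const (s : ℝ)
    rw [div_mul_cancel₀ _ hs'.ne'] at h2
    rw [← NNReal.tendsto_coe]
    refine h2.congr fun n ↦ ?_
    simp only [Function.comp_apply, gridPoint]
    push_cast
    ring

lemma measureReal_passageBy_grid_le (hB : IsPreBrownianReal B P) (hm : ∀ t, Measurable (B t))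
    {s : ℝ≥0} (hs : s ≠ 0) (x : ℝ) (n : ℕ) :
    P.real (passageBy (fun k ↦ B (gridPoint s n k)) x (n + 1)) ≤ 2 * Psi (x / Real.sqrt s) := by
  have := hB.isGaussianProcess.isProbabilityMeasure
  rw [← hB.measureReal_le_eval hs x]
  have h := measureReal_passageBy_le (P := P) (S := fun k ↦ B (gridPoint s n k)) (x := x)
    (n := n + 1) (fun _ ↦ hm _)
    (fun k hk ↦ hB.indepFun_sub_comp (gridPoint_mono s n) hk) (fun k _ ↦ hB.map_neg_sub _ _)
  simpa only [gridPoint_last] using h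

lemma le_measureReal_passageBy_grid (hB : IsPreBrownianReal B P) (hm : ∀ t, Measurable (B t))
    (h0 : ∀ ω, B 0 ω = 0) {s : ℝ≥0} (hs : s ≠ 0) {x : ℝ} (hx : 0 < x) {ε : ℝ} (hε : 0 ≤ ε)
    (n : ℕ) :
    Psi (x / Real.sqrt s) + Psi ((x + 2 * ε) / Real.sqrt s) ≤
      P.real (passageBy (fun k ↦ B (gridPoint s n k)) x (n + 1)) +
        ((n + 1 : ℕ) : ℝ) * Real.exp (-ε ^ 2 / (2 * s)) ^ (n + 1) := by
  have := hB.isGaussianProcess.isProbabilityMeasure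
  have h := le_measureReal_passageBy (P := P) (S := fun k ↦ B (gridPoint s n k)) (x := x)
    (n := n + 1) (fun _ ↦ hm _)
    (fun k hk ↦ hB.indepFun_sub_comp (gridPoint_mono s n) hk) (fun k _ ↦ hB.map_neg_sub _ _)
    (fun ω ↦ by simpa [gridPoint, h0] using hx) hε
  simp only [gridPoint_last] at h
  rw [hB.measureReal_le_eval hs, hB.measureReal_le_eval hs] at h
  refine h.trans (add_le_add_right ?_ _)
  calc
    _ = P.real (⋃ k ∈ Finset.range (n + 1),
        {ω | ε ≤ B (gridPoint s n (k + 1)) ω - B (gridPoint s n k) ω}) := by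
      congr 1
      ext ω
      simp
    _ ≤ ∑ k ∈ Finset.range (n + 1),
        P.real {ω | ε ≤ B (gridPoint s n (k + 1)) ω - B (gridPoint s n k) ω} :=
      measureReal_biUnion_finset_le _ _
    -- Each step has variance `s / (n + 1)`, so the tail bound is an `(n + 1)`-st power, which beats
    -- the number of steps.
    _ ≤ ∑ k ∈ Finset.range (n + 1), Real.exp (-ε ^ 2 / (2 * s)) ^ (n + 1) := by
      refine Finset.sum_le_sum fun k _ ↦ ?_
      rw [gridPoint_succ, hB.measureReal_le_sub _ (by positivity)]
      refine (Psi_le_exp (by positivity)).trans ?_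
      refine (half_le_self (by positivity)).trans_eq ?_
      rw [← Real.exp_nat_mul]
      congr 1
      rw [div_pow, Real.sq_sqrt (by positivity)]
      push_cast
      have : (s : ℝ) ≠ 0 := by exact_mod_cast hs
      field_simp
    _ = _ := by simp

/-- The **reflection principle**: the law of the running maximum of Brownian motion. -/
theorem measureReal_exists_le_brownian (hB : IsPreBrownianReal B P) (hm : ∀ t, Measurable (B t))
    (hc : ∀ ω, Continuous (B · ω)) (h0 : ∀ ω, B 0 ω = 0) {s : ℝ≥0} (hs : s ≠ 0) {x : ℝ}
    (hx : 0 < x) :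
    P.real {ω | ∃ t ≤ s, x ≤ B t ω} = 2 * Psi (x / Real.sqrt s) := by
  have := hB.isGaussianProcess.isProbabilityMeasure
  refine le_antisymm ?_ ?_
  -- Grid points may miss the time at which `x` is reached, but by continuity every fine enough grid
  -- sees a level `y < x`. The grids are not nested, so the increasing sets `A N` replace `F n`.
  · have upper (y : ℝ) (hy : y < x) :
        P.real {ω | ∃ t ≤ s, x ≤ B t ω} ≤ 2 * Psi (y / Real.sqrt s) := by
      set F : ℕ → Set Ω := fun n ↦ passageBy (fun k ↦ B (gridPoint s n k)) y (n + 1)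
      set A : ℕ → Set Ω := fun N ↦ ⋂ n ≥ N, F n
      have hmono : Monotone A := fun i j hij ↦
        Set.biInter_mono (fun n hn ↦ le_trans hij hn) fun _ _ ↦ le_rfl
      have hsub : {ω | ∃ t ≤ s, x ≤ B t ω} ⊆ ⋃ N, A N := by
        rintro ω ⟨t, ht, hxt⟩
        obtain ⟨k, hk, hkt⟩ := exists_tendsto_gridPoint hs ht
        have hlim := ((hc ω).tendsto t).comp hkt
        obtain ⟨N, hN⟩ := eventually_atTop.1 (hlim.eventually_const_le (hy.trans_le hxt))
        exact Set.mem_iUnion.2 ⟨N, Set.mem_iInter₂.2 fun n hn ↦ ⟨k n, hk n, hN n hn⟩⟩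
      refine (measureReal_mono hsub).trans ?_
      have hlim : Tendsto (fun N ↦ P.real (A N)) atTop (𝓝 (P.real (⋃ N, A N))) :=
        (ENNReal.tendsto_toReal (measure_ne_top _ _)).comp (tendsto_measure_iUnion_atTop hmono)
      refine le_of_tendsto' hlim fun N ↦ ?_
      exact (measureReal_mono (Set.biInter_subset_of_mem (le_refl N))).trans
        (measureReal_passageBy_grid_le hB hm hs y N)
    have hcont : Tendsto (fun y ↦ 2 * Psi (y / Real.sqrt s)) (𝓝[<] x)
        (𝓝 (2 * Psi (x / Real.sqrt s))) :=
      (((continuous_Psi.comp (continuous_id.div_const _)).const_mul 2).tendsto x).mono_left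
        nhdsWithin_le_nhds
    exact ge_of_tendsto hcont (eventually_mem_nhdsWithin.mono upper)
  · have lower (ε : ℝ) (hε : 0 < ε) : Psi (x / Real.sqrt s) + Psi ((x + 2 * ε) / Real.sqrt s) ≤
        P.real {ω | ∃ t ≤ s, x ≤ B t ω} := by
      have hr : Real.exp (-ε ^ 2 / (2 * s)) < 1 := by
        have : 0 < (s : ℝ) := by positivity
        rw [Real.exp_lt_one_iff, neg_div, neg_lt_zero]
        positivity
      have hlim := ((tendsto_self_mul_const_pow_of_lt_one (Real.exp_nonneg _) hr).comp
        (tendsto_add_atTop_nat 1)).const_add (P.real {ω | ∃ t ≤ s, x ≤ B t ω})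
      rw [add_zero] at hlim
      refine ge_of_tendsto' hlim fun n ↦ ?_
      refine (le_measureReal_passageBy_grid hB hm h0 hs hx hε.le n).trans ?_
      refine add_le_add_left (measureReal_mono ?_) _
      rintro ω ⟨k, hk, hkx⟩
      exact ⟨_, gridPoint_le hk, hkx⟩
    have hcont : Tendsto (fun ε ↦ Psi (x / Real.sqrt s) + Psi ((x + 2 * ε) / Real.sqrt s))
        (𝓝[>] 0) (𝓝 (Psi (x / Real.sqrt s) + Psi ((x + 2 * 0) / Real.sqrt s))) := by
      refine Tendsto.mono_left (Continuous.tendsto ?_ 0) nhdsWithin_le_nhds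
      exact continuous_const.add (continuous_Psi.comp (by fun_prop))
    rw [mul_zero, add_zero, ← two_mul] at hcont
    exact le_of_tendsto hcont (eventually_mem_nhdsWithin.mono lower)

/-- The probability that Brownian motion visits `v` before time `s`. -/
theorem measureReal_exists_brownian_eq (hB : IsPreBrownianReal B P) (hm : ∀ t, Measurable (B t))
    (hc : ∀ ω, Continuous (B · ω)) (h0 : ∀ ω, B 0 ω = 0) {s : ℝ≥0} (hs : s ≠ 0) (v : ℝ) :
    P.real {ω | ∃ t ≤ s, B t ω = v} = 2 * Psi (|v| / Real.sqrt s) := by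
  have := hB.isGaussianProcess.isProbabilityMeasure
  have pos {B : ℝ≥0 → Ω → ℝ} (hB : IsPreBrownianReal B P) (hm : ∀ t, Measurable (B t))
      (hc : ∀ ω, Continuous (B · ω)) (h0 : ∀ ω, B 0 ω = 0) {v : ℝ} (hv : 0 < v) :
      P.real {ω | ∃ t ≤ s, B t ω = v} = 2 * Psi (|v| / Real.sqrt s) := by
    rw [abs_of_pos hv, ← measureReal_exists_le_brownian hB hm hc h0 hs hv]
    congr 1
    ext ω
    refine ⟨fun ⟨t, ht, h⟩ ↦ ⟨t, ht, h.ge⟩, fun ⟨t, ht, h⟩ ↦ ?_⟩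
    -- Starting from `0`, a continuous path that gets above `v > 0` has taken the value `v`;
    -- negative levels follow by passing to `-B`.
    obtain ⟨u, hu, hu'⟩ := intermediate_value_Icc (zero_le (a := t)) (hc ω).continuousOn
      ⟨(h0 ω).trans_le hv.le, h⟩
    exact ⟨u, hu.2.trans ht, hu'⟩
  rcases lt_trichotomy v 0 with hv | rfl | hv
  · have h := pos hB.neg (fun t ↦ (hm t).neg) (fun ω ↦ (hc ω).neg) (fun ω ↦ by simp [h0])
      (neg_pos.2 hv)
    rw [abs_neg] at h
    rw [← h]
    simp
  · have : {ω | ∃ t ≤ s, B t ω = 0} = Set.univ :=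
      Set.eq_univ_of_forall fun ω ↦ ⟨0, zero_le, h0 ω⟩
    rw [this]
    simp [Psi_zero]
  · exact pos hB hm hc h0 hv

end Reflection

/-! ### A measurable version with continuous paths. -/

section Version

open Filter Topology

variable {Ω : Type*} {mΩ : MeasurableSpace Ω} {P : Measure Ω} {W : ℝ≥0 → Ω → ℝ}

/-- A Brownian motion is indistinguishable from one which is measurable at every time and has
only continuous paths. -/
lemma ProbabilityTheory.IsBrownianReal.exists_measurable_continuous (hW : IsBrownianReal W P) :
    ∃ V : ℝ≥0 → Ω → ℝ, (∀ t, Measurable (V t)) ∧ (∀ ω, Continuous (V · ω)) ∧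
      IsPreBrownianReal V P ∧ ∀ᵐ ω ∂P, ∀ t, W t ω = V t ω := by
  set d := TopologicalSpace.denseSeq ℝ≥0
  set W' := fun t ↦ (hW.aemeasurable t).mk (W t)
  have hae : ∀ᵐ ω ∂P, Continuous (W · ω) ∧ ∀ n, W (d n) ω = W' (d n) ω :=
    hW.cont.and (ae_all_iff.2 fun n ↦ (hW.aemeasurable (d n)).ae_eq_mk)
  obtain ⟨N, hN, hNm, hN0⟩ := exists_measurable_superset_of_null (ae_iff.1 hae)
  have hgood (ω) (hω : ω ∈ Nᶜ) : Continuous (W · ω) ∧ ∀ n, W (d n) ω = W' (d n) ω := by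
    by_contra h
    exact hω (hN h)
  have hNae : ∀ᵐ ω ∂P, ω ∈ Nᶜ := measure_eq_zero_iff_ae_notMem.1 hN0
  -- Zeroing the paths on a measurable null set makes them all continuous. Measurability, known at
  -- the dense times, then passes to every time as a pointwise limit.
  set V : ℝ≥0 → Ω → ℝ := fun t ↦ Nᶜ.indicator (W t) with hVdef
  have hVc (ω) : Continuous (V · ω) := by
    by_cases h : ω ∈ Nᶜ
    · simpa only [hVdef, Set.indicator_of_mem h] using (hgood ω h).1
    · simpa only [hVdef, Set.indicator_of_notMem h] using continuous_const
  have hVd (n) : Measurable (V (d n)) := by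
    have : V (d n) = Nᶜ.indicator (W' (d n)) :=
      Set.indicator_congr fun ω hω ↦ (hgood ω hω).2 n
    rw [this]
    exact (hW.aemeasurable (d n)).measurable_mk.indicator hNm.compl
  have hVW : ∀ᵐ ω ∂P, ∀ t, W t ω = V t ω := by
    filter_upwards [hNae] with ω hω t
    exact (Set.indicator_of_mem hω _).symm
  refine ⟨V, fun t ↦ ?_, hVc, hW.toIsPreBrownianReal.congr fun t ↦ hVW.mono fun ω h ↦ h t, hVW⟩
  obtain ⟨u, hu, hut⟩ := mem_closure_iff_seq_limit.1
    ((TopologicalSpace.denseRange_denseSeq ℝ≥0) t)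
  refine measurable_of_tendsto_metrizable (f := fun k ↦ V (u k)) (fun k ↦ ?_)
    (tendsto_pi_nhds.2 fun ω ↦ ((hVc ω).tendsto t).comp hut)
  obtain ⟨n, hn⟩ := hu k
  rw [← hn]
  exact hVd n

end Version

/-! ### Vanishing infimum and attained values. -/

section Hitting

variable {T : Type*} [TopologicalSpace T] [CompactSpace T] [Nonempty T]

/-- Compactness provides a minimiser, and density transfers its value to the family `d`. Taking `d`
countable gives measurability; taking `d = id` treats the original infimum. -/
lemma iInf_abs_sub_eq_zero_iff {f : T → ℝ} (hf : Continuous f) (v : ℝ) {ι : Type*}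
    {d : ι → T} (hd : DenseRange d) : ⨅ i, |f (d i) - v| = 0 ↔ ∃ t, f t = v := by
  have hg : Continuous fun t ↦ |f t - v| := (hf.sub continuous_const).abs
  have hbdd : BddBelow (Set.range fun i ↦ |f (d i) - v|) :=
    ⟨0, Set.forall_mem_range.2 fun _ ↦ abs_nonneg _⟩
  have : Nonempty ι := hd.nonempty
  constructor
  · intro h
    obtain ⟨t, -, ht⟩ := isCompact_univ.exists_isMinOn Set.univ_nonempty hg.continuousOn
    refine ⟨t, sub_eq_zero.1 (abs_nonpos_iff.1 ?_)⟩
    rw [← h]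
    exact le_ciInf fun i ↦ ht (Set.mem_univ _)
  · rintro ⟨t, ht⟩
    refine le_antisymm (le_of_forall_pos_lt_add fun ε hε ↦ ?_) (Real.iInf_nonneg fun _ ↦ abs_nonneg _)
    obtain ⟨i, hi⟩ := hd.exists_mem_open (hg.isOpen_preimage _ (isOpen_Iio (a := ε)))
      ⟨t, by simpa [ht] using hε⟩
    exact (ciInf_le hbdd i).trans_lt (by simpa using hi)

end Hitting

/-! ### The exact formula, by conditioning on the value at time `a`. -/

section Formula

variable {Ω : Type*} {mΩ : MeasurableSpace Ω} {P : Measure Ω} {W : ℝ≥0 → Ω → ℝ} {a b : ℝ≥0}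

/-- Pairs of a path `p` and a level `v` such that `p` comes arbitrarily close to `v` along a
countable dense set of times in `[0, s]`. -/
def nearHits (s : ℝ≥0) : Set ((ℝ≥0 → ℝ) × ℝ) :=
  {q | ⨅ n, |q.1 (TopologicalSpace.denseSeq (Set.Iic s) n) - q.2| = 0}

lemma measurableSet_nearHits (s : ℝ≥0) : MeasurableSet (nearHits s) := by
  refine measurableSet_eq_fun (Measurable.iInf fun n ↦ ?_) measurable_const
  fun_prop

lemma mem_nearHits_iff {s : ℝ≥0} {p : ℝ≥0 → ℝ} (hp : Continuous p) (v : ℝ) :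
    (p, v) ∈ nearHits s ↔ ∃ t ≤ s, p t = v := by
  have : CompactSpace (Set.Iic s) := by
    rw [← isCompact_iff_compactSpace, ← Set.Icc_bot]
    exact isCompact_Icc
  have := iInf_abs_sub_eq_zero_iff (T := Set.Iic s) (f := fun t ↦ p t) (by fun_prop) v
    (TopologicalSpace.denseRange_denseSeq _)
  refine this.trans ?_
  simp

lemma mem_infZeroEvent_iff (hab : a ≤ b) {ω : Ω} (hω : Continuous (W · ω)) (M : ℝ) :
    ω ∈ infZeroEvent W a b M ↔ ∃ t ∈ Set.Icc a b, W t ω = M := by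
  have : Nonempty (Set.Icc a b) := ⟨⟨a, le_rfl, hab⟩⟩
  have := iInf_abs_sub_eq_zero_iff (T := Set.Icc a b) (f := fun t ↦ W t ω)
    (hω.comp continuous_subtype_val) M (d := id) denseRange_id
  refine this.trans ?_
  simp

lemma integral_gaussianReal_Psi (ha : a ≠ 0) (M : ℝ) :
    ∫ y, 2 * Psi (|M - y| / Real.sqrt (b - a)) ∂(gaussianReal 0 a) =
      2 * ∫ v, hitIntegrand a b M v := by
  rw [integral_gaussianReal_eq_integral_smul ha, ← integral_const_mul,
    ← integral_add_left_eq_self _ M]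
  congr 1
  ext v
  simp only [gaussianPDFReal, hitIntegrand, sub_add_cancel_left, abs_neg, smul_eq_mul, sub_zero]
  ring

lemma measure_infZeroEvent (hW : IsBrownianReal W P) (M : ℝ) (ha : 0 < a) (hab : a < b) :
    NullMeasurableSet (infZeroEvent W a b M) P ∧
      P.real (infZeroEvent W a b M) = 2 * ∫ v, hitIntegrand a b M v := by
  obtain ⟨V, hVm, hVc, hV, hWV⟩ := hW.exists_measurable_continuous
  have := hV.isGaussianProcess.isProbabilityMeasure
  set s := b - a with hs
  have hs0 : s ≠ 0 := (tsub_pos_of_lt hab).ne'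
  set B : ℝ≥0 → Ω → ℝ := fun t ω ↦ V (a + t) ω - V a ω with hBdef
  have hB : IsPreBrownianReal B P := hV.shift a
  have hBm (t) : Measurable (B t) := (hVm _).sub (hVm _)
  have hBc (ω) : Continuous (B · ω) := by
    have := hVc ω
    simp only [hBdef]
    fun_prop
  have hB0 (ω) : B 0 ω = 0 := by simp [hBdef]
  have hpath : Measurable fun ω t ↦ B t ω := measurable_pi_lambda _ hBm
  have hX : Measurable fun ω ↦ M - V a ω := (hVm a).const_sub M
  have heval : Measurable fun p : Set.Iic a → ℝ ↦ p ⟨a, Set.self_mem_Iic⟩ :=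
    measurable_pi_apply _
  have hind : IndepFun (fun ω t ↦ B t ω) (V a) P :=
    (hV.indepFun_shift a).comp measurable_id heval
  set T : Set ((ℝ≥0 → ℝ) × ℝ) := (fun q ↦ (q.1, M - q.2)) ⁻¹' nearHits s
  have hT : MeasurableSet T := measurableSet_nearHits s |>.preimage (by fun_prop)
  have hpair : Measurable fun ω ↦ ((fun t ↦ B t ω), V a ω) := hpath.prodMk (hVm a)
  have hev : infZeroEvent W a b M =ᵐ[P] (fun ω ↦ ((fun t ↦ B t ω), V a ω)) ⁻¹' T := by
    filter_upwards [hWV] with ω hω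
    refine propext ?_
    change ω ∈ infZeroEvent W a b M ↔ ((fun t ↦ B t ω), M - V a ω) ∈ nearHits s
    have hWc : Continuous (W · ω) := by
      simpa only [hω] using hVc ω
    rw [mem_infZeroEvent_iff hab.le hWc, mem_nearHits_iff (hBc ω)]
    simp only [hω, hBdef]
    constructor
    · rintro ⟨t, ⟨h1, h2⟩, h3⟩
      refine ⟨t - a, tsub_le_tsub_right h2 a, ?_⟩
      rw [add_tsub_cancel_of_le h1, h3]
    · rintro ⟨t, h1, h2⟩
      refine ⟨a + t, ⟨le_self_add, ?_⟩, by linarith⟩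
      calc a + t ≤ a + s := by gcongr
        _ = b := add_tsub_cancel_of_le hab.le
  refine ⟨(hpair hT).nullMeasurableSet.congr hev.symm, ?_⟩
  have hlaw : P.map (V a) = gaussianReal 0 a := (hV.hasLaw_eval a).map_eq
  have hprod := (indepFun_iff_map_prod_eq_prod_map_map hpath.aemeasurable
    (hVm a).aemeasurable).1 hind
  have : IsProbabilityMeasure (P.map fun ω t ↦ B t ω) :=
    Measure.isProbabilityMeasure_map hpath.aemeasurable
  -- Independence makes the joint law of the restarted path and `V a` a product, so Fubini
  -- integrates the hitting probability over `y = V a`.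
  rw [measureReal_congr hev, measureReal_def, ← Measure.map_apply hpair hT, hprod, hlaw,
    Measure.prod_apply_symm hT, ← integral_toReal
      (measurable_measure_prodMk_right hT).aemeasurable (.of_forall fun _ ↦ measure_lt_top _ _),
    ← integral_gaussianReal_Psi ha.ne']
  congr 1
  ext y
  rw [Measure.map_apply hpath (measurable_prodMk_right hT)]
  -- `s` is a truncated difference; it agrees with the real one because `a ≤ b`.
  have hcast : (b : ℝ) - a = s := (NNReal.coe_sub hab.le).symm
  rw [hcast, ← measureReal_exists_brownian_eq hB hBm hBc hB0 hs0 (M - y)]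
  refine congrArg P.real ?_
  ext ω
  exact mem_nearHits_iff (hBc ω) _

end Formula

theorem lemma2p2 :
    ∃ C : ℝ, ∀ (Ω : Type*) (mΩ : MeasurableSpace Ω) (P : Measure Ω) (_ : IsProbabilityMeasure P)
      (W : ℝ≥0 → Ω → ℝ) (_ : IsBrownianReal W P) (M : ℝ) (a b : ℝ≥0) (_ : 0 < a) (_ : a < b),
      NullMeasurableSet (infZeroEvent W a b M) P ∧
      Integrable (hitIntegrand a b M) ∧
      P.real (infZeroEvent W a b M) = 2 * ∫ v, hitIntegrand a b M v ∧
      P.real (infZeroEvent W a b M) ≤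
        C * min 1 (Real.sqrt (((b : ℝ) - a) / a) *
          Real.exp (-M ^ 2 / (8 * max (a : ℝ) ((b : ℝ) - a)))) ∧
      P.real (infZeroEvent W a b M) ≤ C * min 1 (Real.sqrt (((b : ℝ) - a) / a)) := by
  refine ⟨1, fun Ω mΩ P _ W hW M a b ha hab ↦ ?_⟩
  obtain ⟨h1, h2⟩ := measure_infZeroEvent hW M ha hab
  have ha' : (0 : ℝ) < a := ha
  have hab' : (a : ℝ) < b := hab
  have h3 := two_mul_integral_hitIntegrand_le_sqrt_mul_exp ha' hab' M
  rw [← h2] at h3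
  have h4 : Real.exp (-M ^ 2 / (8 * max (a : ℝ) ((b : ℝ) - a))) ≤ 1 := by
    rw [Real.exp_le_one_iff, neg_div, neg_nonpos]
    have : 0 < max (a : ℝ) ((b : ℝ) - a) := lt_max_of_lt_left ha'
    positivity
  rw [one_mul, one_mul]
  refine ⟨h1, integrable_hitIntegrand ha' hab' M, h2, le_min measureReal_le_one h3,
    le_min measureReal_le_one (h3.trans ?_)⟩
  exact mul_le_of_le_one_right (Real.sqrt_nonneg _) h4
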